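/- Setting. Fix $m\in\mathbb N$. Let $\mathcal M$ be a set of arms, each arm $M\in\mathcal M$ being a set of $m$ basic actions in $[d]=\{1,\dots,d\}$, identified with its indicator vector $M\in\{0,1\}^d$. The rewards $X_i(n)$ ($i\in[d]$, $n\ge1$) are independent over $i$ and $n$, and $X_i(n)$ is Bernoulli with mean $\theta_i$, where $\theta\in[0,1]^d$. An arbitrary policy selects in each round $n\geq 1$ an arm $M(n)\in\mathcal M$ as a function of the arms selected in previous rounds, of the rewards of the basic actions in these arms (semi-bandit feedback), and of an internal randomization independent of the rewards. Let $t_i(n)=\sum_{s=1}^n M_i(s)$, and let $\hat\theta_i(n)=t_i(n)^{-1}\sum_{s=1}^n M_i(s)X_i(s)$ if $t_i(n)>0$ and $\hat\theta_i(n)=0$ otherwise. Let $f(n)=\log n+4m\log\log n$ (so $f(1)=-\infty$) and $\mathrm{kl}(u,v)=u\log\frac uv+(1-u)\log\frac{1-u}{1-v}\in[0,\infty]$, the Kullback–Leibler divergence between the Bernoulli laws of means $u$ and $v$. For $\tau\in[0,1]^d$ and the numbers of samples $t=t(n)$, define $$b_M(n,\tau)=\max\Big\{M^\top q:\ q\in[0,1]^d,\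 \sum_{i=1}^d M_i\,t_i\,\mathrm{kl}(\tau_i,q_i)\le f(n)\Big\},\qquad c_M(n,\tau)=M^\top\tau+\sqrt{\frac{f(n)}2\sum_{i=1}^d\frac{M_i}{t_i}},$$ where $0\cdot\infty=0$, $1/0=\infty$, the maximum over the empty set is $-\infty$, and (only relevant when $f(n)<0$, in which case $b_M(n,\tau)=-\infty$) the square root of a negative quantity is read as $0$. Write $b_M(n)=b_M(n,\hat\theta(n))$ and $c_M(n)=c_M(n,\hat\theta(n))$. Theorem 3. (i) For all $n\ge1$, $M\in\mathcal M$, $\tau\in[0,1]^d$ and all numbers of samples $t\in\mathbb N^d$, $b_M(n,\tau)\le c_M(n,\tau)$. (ii) There is a constant $C_m>0$ depending on $m$ only such that, for all $d$, $\mathcal M$, $\theta$, all policies, all $M\in\mathcal M$ and all $n\ge2$, $$\mathbb P[b_M(n)<M^\top\theta]\le C_m n^{-1}(\log n)^{-2},$$ and also $\mathbb P[b_M(n)\le M^\top\theta]\le C_m n^{-1}(\log n)^{-2}$ unless $\theta_i=1$ for all $i\in M$. Consequently, with the same $C_m$, if $M^\star\in\mathcal M$ is an arm with the largest expected reward $\mu^\star=M^{\star\top}\theta$,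 then $$\sum_{n\ge1}\mathbb P[b_{M^\star}(n)<\mu^\star]\le 1+C_m\sum_{n\ge2}n^{-1}(\log n)^{-2}<\infty ,$$ and the expected number of rounds $n\geq 1$ in which $b_{M^\star}(n)<\mu^\star$ has the same bound, so that it is finite. The same holds with $c_{M^\star}$ in place of $b_{M^\star}$ and, unless $\theta_i=1$ for all $i\in M^\star$, with $\le\mu^\star$ in place of $<\mu^\star$ for both indexes. -/

import Mathlib

open MeasureTheory ProbabilityTheory
open scoped ENNReal

noncomputable section

namespace CombBandit

/-- Kullback-Leibler divergence between the Bernoulli laws of means `u, v ∈ [0,1]`: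
`u log (u/v) + (1-u) log ((1-u)/(1-v))`, with `0 log (0/v) = 0` and `u log (u/0) = ∞` for `u > 0`. -/
def kl (u v : ℝ) : EReal :=
  open Classical in
  if (v = 0 ∧ u ≠ 0) ∨ (v = 1 ∧ u ≠ 1) then ⊤
  else ((u * Real.log (u / v) + (1 - u) * Real.log ((1 - u) / (1 - v)) : ℝ) : EReal)

/-- `f(n) = log n + 4 m log (log n)`, which is `-∞` for `n = 1`. -/
def f (m n : ℕ) : EReal :=
  if n ≤ 1 then ⊥
  else ((Real.log n + 4 * m * Real.log (Real.log n) : ℝ) : EReal)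

/-- The scalar product `Mᵀ q`, an arm `M` being a set of basic actions. -/
def dot {d : ℕ} (M : Finset (Fin d)) (q : Fin d → ℝ) : ℝ := ∑ i ∈ M, q i

/-- The feasible set `{q ∈ [0,1]^d : (M t)ᵀ kl(τ, q) ≤ f(n)}`, for numbers of samples `t` and
empirical means `τ`. -/
def feasible {d : ℕ} (m n : ℕ) (t : Fin d → ℕ) (τ : Fin d → ℝ) (M : Finset (Fin d)) :
    Set (Fin d → ℝ) :=
  {q | (∀ i, q i ∈ Set.Icc (0 : ℝ) 1) ∧ ∑ i ∈ M, (t i : EReal) * kl (τ i) (q i) ≤ f m n}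

/-- The index `b_M(n, τ)`: the largest value of `Mᵀ q` over the feasible set (`-∞` if there is no
feasible point, which happens only when `f(n) < 0`). -/
def b {d : ℕ} (m n : ℕ) (t : Fin d → ℕ) (τ : Fin d → ℝ) (M : Finset (Fin d)) : EReal :=
  ⨆ q ∈ feasible m n t τ M, ((dot M q : ℝ) : EReal)

/-- The index `c_M(n, τ) = Mᵀ τ + √((f(n)/2) ∑ M_i / t_i)`, where `1 / 0 = ∞`; the square root of a
negative number is read as `0`. -/
def c {d : ℕ} (m n : ℕ) (t : Fin d → ℕ) (τ : Fin d → ℝ) (M : Finset (Fin d)) : EReal :=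
  ((dot M τ : ℝ) : EReal) +
    ((((f m n).toENNReal / 2 * ∑ i ∈ M, (t i : ℝ≥0∞)⁻¹) ^ (1 / 2 : ℝ) : ℝ≥0∞) : EReal)

/-! Rounds are numbered from `1`; the entry with index `s` of a sequence belongs to round `s + 1`,
so that `Finset.range n` runs over the rounds `1, …, n`. -/

/-- The rewards: `X s i` has the Bernoulli law of mean `θ i`, and the rewards are independent over
rounds and basic actions. -/
structure IsRewards {d : ℕ} {Ω : Type*} [MeasurableSpace Ω] (P : Measure Ω)
    (θ : Fin d → unitInterval) (X : ℕ → Fin d → Ω → ℝ) : Prop where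
  measurable : ∀ s i, Measurable (X s i)
  law : ∀ s i, P.map (X s i) = bernoulliMeasure (1 : ℝ) 0 (θ i)
  indep : iIndepFun (fun p : ℕ × Fin d => X p.1 p.2) P

/-- What is revealed of the reward vector at index `s` if the arm `A s` is selected: the components
in `A s` (the others are masked by `0`). -/
def revealed {d : ℕ} {Ω : Type*} (X : ℕ → Fin d → Ω → ℝ) (A : ℕ → Ω → Finset (Fin d)) (s : ℕ)
    (ω : Ω) : Fin d → ℝ :=
  fun i => if i ∈ A s ω then X s i ω else 0

/-- The information available when the arm with index `s` is selected: the internal randomization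
`U`, and the arms selected and the rewards revealed before. -/
@[reducible] def information {d : ℕ} {Ω S : Type*} [MeasurableSpace S] (U : Ω → S)
    (X : ℕ → Fin d → Ω → ℝ) (A : ℕ → Ω → Finset (Fin d)) (s : ℕ) : MeasurableSpace Ω :=
  MeasurableSpace.comap U inferInstance ⊔
    ⨆ r : ℕ, ⨆ _ : r < s, (MeasurableSpace.comap (A r) ⊤ ⊔
      MeasurableSpace.comap (revealed X A r) inferInstance)

/-- `A` is the sequence of arms selected by a feasible policy under semi-bandit feedback: each one
belongs to the set `ℳ` of arms, and is determined by the previously selected arms, their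
revealed rewards, and a randomization `U` that is independent of all the rewards. -/
structure IsPolicy {d : ℕ} {Ω S : Type*} [MeasurableSpace Ω] [MeasurableSpace S] (P : Measure Ω)
    (ℳ : Finset (Finset (Fin d))) (X : ℕ → Fin d → Ω → ℝ) (U : Ω → S)
    (A : ℕ → Ω → Finset (Fin d)) : Prop where
  mem : ∀ s ω, A s ω ∈ ℳ
  measurable_seed : Measurable U
  indep : IndepFun U (fun ω (p : ℕ × Fin d) => X p.1 p.2 ω) P
  nonanticipating : ∀ s M, MeasurableSet[information U X A s] {ω | A s ω = M}

/-- `t_i(n)`: the number of times that the basic action `i` is sampled in the rounds `1, …, n`. -/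
def count {d : ℕ} {Ω : Type*} (A : ℕ → Ω → Finset (Fin d)) (n : ℕ) (ω : Ω) (i : Fin d) : ℕ :=
  ((Finset.range n).filter fun s => i ∈ A s ω).card

/-- `θ̂_i(n)`: the empirical mean reward of `i` over the rounds `1, …, n` (`0` if not sampled). -/
def empMean {d : ℕ} {Ω : Type*} (X : ℕ → Fin d → Ω → ℝ) (A : ℕ → Ω → Finset (Fin d)) (n : ℕ)
    (ω : Ω) (i : Fin d) : ℝ :=
  if count A n ω i = 0 then 0
  else (∑ s ∈ (Finset.range n).filter (fun s => i ∈ A s ω), X s i ω) / (count A n ω i : ℝ)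

/-- The random index `b_M(n) = b_M(n, θ̂(n))`. -/
def bHat {d : ℕ} {Ω : Type*} (m : ℕ) (X : ℕ → Fin d → Ω → ℝ) (A : ℕ → Ω → Finset (Fin d))
    (M : Finset (Fin d)) (n : ℕ) (ω : Ω) : EReal :=
  b m n (count A n ω) (empMean X A n ω) M

/-- The random index `c_M(n) = c_M(n, θ̂(n))`. -/
def cHat {d : ℕ} {Ω : Type*} (m : ℕ) (X : ℕ → Fin d → Ω → ℝ) (A : ℕ → Ω → Finset (Fin d))
    (M : Finset (Fin d)) (n : ℕ) (ω : Ω) : EReal :=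
  c m n (count A n ω) (empMean X A n ω) M

/-- The expected reward `μ_M(θ) = Mᵀ θ` of the arm `M`. -/
def meanReward {d : ℕ} (θ : Fin d → unitInterval) (M : Finset (Fin d)) : EReal :=
  ((dot M (fun i => (θ i : ℝ)) : ℝ) : EReal)

/-- The bound `C n⁻¹ (log n)⁻²`. -/
def rate (C : ℝ) (n : ℕ) : ℝ≥0∞ := ENNReal.ofReal (C * (n : ℝ)⁻¹ * ((Real.log n) ^ 2)⁻¹)

/-- The bound `1 + C ∑_{n ≥ 2} n⁻¹ (log n)⁻²`. -/
def totalBound (C : ℝ) : ℝ≥0∞ := 1 + ∑' k : ℕ, rate C (k + 2)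

/-- The expected number of rounds `n ≥ 1` in which the event `E n` occurs. -/
def expectedRounds {Ω : Type*} [MeasurableSpace Ω] (P : Measure Ω) (E : ℕ → Set Ω) : ℝ≥0∞ :=
  ∫⁻ ω, ((Set.encard {n : ℕ | 1 ≤ n ∧ ω ∈ E n} : ℕ∞) : ℝ≥0∞) ∂P

/-- `∑_{n ≥ 1} P[E n] ≤ K`, and so is the expected number of rounds in which `E n` occurs. -/
def RoundsBoundedBy {Ω : Type*} [MeasurableSpace Ω] (P : Measure Ω) (E : ℕ → Set Ω)
    (K : ℝ≥0∞) : Prop :=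
  ∑' k : ℕ, P (E (k + 1)) ≤ K ∧ expectedRounds P E ≤ K

end CombBandit

end

noncomputable section

namespace CombBandit

/-! For (i), Pinsker's inequality turns feasibility of `q` into `∑ t_i (q_i - τ_i)² ≤ f(n) / 2` over
`i ∈ M`, and Cauchy–Schwarz then bounds `Mᵀ(q - τ)` (`b_le_c`).

For (ii), only downward deviations matter. The point `q_i = max (θ̂_i, θ_i)` costs `∑ t_i dev(θ̂_i,
θ_i)`; if this is below `f(n)`, then `q` is feasible and the index is at least `Mᵀθ`. The slack even
allows one coordinate with `θ_i < 1` to be raised, which makes the inequality strict. It remains to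
bound the probability that this sum reaches `δ = f(n)` (`measure_le_totalDev_le`).

For one action and one level `a`, let `q < θ_i` have divergence `a` from `θ_i`. A deviation above
`a` after `t` samples forces the likelihood ratio of mean `q` against mean `θ_i` to be at least `exp
(t a)`, for every `t` at once (`exists_test`), so no union over sample counts is needed. A geometric
grid of `O(δ²)` levels loses at most 1 in the exponent per action (`exists_levels`). For one test
per action of `M`, the product of the ratios over the sampled rewards has mean at most 1 under any
policy, since the arm is chosen independently of the rewards of its round
(`lintegral_ratio_le_one`). Markov's inequality and a union over the at most `(7 δ²)^m` choices of
tests give `(7 δ²)^m exp (m - δ)`. At `δ = f(n)` the factor `(log n)^(-4m)` absorbs `δ^(2m)` and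
leaves a summable bound. -/

/-! ### Bernoulli divergence: Pinsker's inequality and monotonicity -/

/-- The real-valued formula for the Bernoulli Kullback-Leibler divergence. -/
def klR (u v : ℝ) : ℝ := u * Real.log (u / v) + (1 - u) * Real.log ((1 - u) / (1 - v))

lemma klR_self (u : ℝ) : klR u u = 0 := by
  unfold klR
  by_cases h : u = 0
  · simp [h]
  by_cases h' : 1 - u = 0
  · simp [h', h]
  simp [h, h']

lemma klR_one_sub (u v : ℝ) : klR (1 - u) (1 - v) = klR u v := by
  unfold klR; simp; ring

/-- The difference of the two sides vanishes at `v = u`, and its derivative in `v` is `(v - u)(1 -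
2v)² / (v(1 - v)) ≥ 0`. -/
lemma klR_ge_of_le {u v : ℝ} (hu : 0 ≤ u) (huv : u ≤ v) (hv : v < 1) :
    2 * (u - v) ^ 2 ≤ klR u v := by
  let g : ℝ → ℝ := fun x => u * Real.log u - u * Real.log x + (1 - u) * Real.log (1 - u)
    - (1 - u) * Real.log (1 - x) - 2 * (u - x) ^ 2
  have key : ∀ x, u ≤ x → x < 1 → klR u x - 2 * (u - x) ^ 2 = g x := by
    intro x hux hx
    have h1 : 1 - x ≠ 0 := by linarith
    have h2 : 1 - u ≠ 0 := by linarith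
    simp only [klR, g]
    rw [Real.log_div h2 h1]
    rcases hu.eq_or_lt with h | h
    · subst h; simp
    · rw [Real.log_div h.ne' (by linarith)]; ring
  have hder : ∀ x ∈ Set.Ioo u v, HasDerivAt g
      (-(u * x⁻¹) + (1 - u) * (1 - x)⁻¹ + 4 * (u - x)) x := by
    intro x hx
    have hx0 : x ≠ 0 := by linarith [hx.1]
    have hx1 : 1 - x ≠ 0 := by linarith [hx.2]
    have a1 : HasDerivAt (fun x => Real.log (1 - x)) ((1 - x)⁻¹ * (-1)) x := by
      have := ((hasDerivAt_id x).const_sub 1).log hx1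
      simpa [div_eq_inv_mul] using this
    have a2 : HasDerivAt (fun x => (u - x) ^ 2) (2 * (u - x) * (-1)) x := by
      have := ((hasDerivAt_id x).const_sub u).pow 2
      exact this.congr_deriv (by simp)
    have := (((((Real.hasDerivAt_log hx0).const_mul u).const_sub (u * Real.log u)).add_const
      ((1 - u) * Real.log (1 - u))).sub (a1.const_mul (1 - u))).sub (a2.const_mul 2)
    exact this.congr_deriv (by ring)
  have hcont : ContinuousOn g (Set.Icc u v) := by
    have e1 : ContinuousOn (fun x => u * Real.log x) (Set.Icc u v) := by
      rcases hu.eq_or_lt with h | h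
      · subst h; simpa using continuousOn_const
      · exact continuousOn_const.mul (Real.continuousOn_log.mono fun x hx => by
          have := hx.1; simp; linarith)
    have e2 : ContinuousOn (fun x => Real.log (1 - x)) (Set.Icc u v) :=
      ContinuousOn.log (by fun_prop) fun x hx => by linarith [hx.2]
    simp only [g]
    fun_prop
  have hmono : MonotoneOn g (Set.Icc u v) := by
    apply monotoneOn_of_deriv_nonneg (convex_Icc u v) hcont
    · rw [interior_Icc]
      exact fun x hx => (hder x hx).differentiableAt.differentiableWithinAt
    · rw [interior_Icc]
      intro x hx
      rw [(hder x hx).deriv]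
      have hx0 : 0 < x := by linarith [hx.1]
      have hx1 : 0 < 1 - x := by linarith [hx.2]
      have : -(u * x⁻¹) + (1 - u) * (1 - x)⁻¹ + 4 * (u - x)
          = (x - u) * (1 - 2 * x) ^ 2 * (x⁻¹ * (1 - x)⁻¹) := by
        field_simp; ring
      rw [this]
      have := hx.1
      have : 0 ≤ x - u := by linarith
      positivity
  have := hmono ⟨le_rfl, huv⟩ ⟨huv, le_rfl⟩ huv
  rw [← key u le_rfl (by linarith), ← key v huv hv, klR_self] at this
  simp at this
  linarith

/-- **Pinsker's inequality** for Bernoulli laws. -/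
lemma two_mul_sq_le_klR {u v : ℝ} (hu : u ∈ Set.Icc (0 : ℝ) 1) (hv : v ∈ Set.Ioo (0 : ℝ) 1) :
    2 * (u - v) ^ 2 ≤ klR u v := by
  rcases le_total u v with h | h
  · exact klR_ge_of_le hu.1 h hv.2
  · have := klR_ge_of_le (u := 1 - u) (v := 1 - v) (by linarith [hu.2]) (by linarith)
      (by linarith [hv.1])
    rw [klR_one_sub] at this
    linarith

/-- Three-point identity: `klR p v - klR q v` equals `klR p q` plus `(q - p)` times a difference of
log-odds, and both are nonnegative. -/
lemma klR_anti {p q v : ℝ} (hp : 0 < p) (hpq : p ≤ q) (hqv : q ≤ v) (hv : v < 1) :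
    klR q v ≤ klR p v := by
  have hq : 0 < q := by linarith
  have h := two_mul_sq_le_klR (u := p) (v := q) ⟨hp.le, by linarith⟩ ⟨hq, by linarith⟩
  have h0 : 0 ≤ klR p q := le_trans (by positivity) h
  have a1 : Real.log q ≤ Real.log v := Real.log_le_log hq hqv
  have a2 : Real.log (1 - v) ≤ Real.log (1 - q) := Real.log_le_log (by linarith) (by linarith)
  unfold klR at *
  rw [Real.log_div (by linarith) (by linarith), Real.log_div (by linarith) (by linarith)] at h0
  rw [Real.log_div (by linarith) (by linarith), Real.log_div (by linarith) (by linarith),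
    Real.log_div (by linarith) (by linarith), Real.log_div (by linarith) (by linarith)]
  nlinarith [mul_nonneg (sub_nonneg.2 hpq) (sub_nonneg.2 a1),
    mul_nonneg (sub_nonneg.2 hpq) (sub_nonneg.2 a2)]

lemma kl_eq_coe {u v : ℝ} (h : v = 0 → u = 0) (h' : v = 1 → u = 1) :
    kl u v = (klR u v : EReal) := by
  unfold kl klR
  rw [if_neg (by tauto)]

lemma kl_self (u : ℝ) : kl u u = 0 := by
  rw [kl_eq_coe id id, klR_self]; rfl

lemma two_mul_sq_le_kl {u v : ℝ} (hu : u ∈ Set.Icc (0 : ℝ) 1) (hv : v ∈ Set.Icc (0 : ℝ) 1) :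
    ((2 * (u - v) ^ 2 : ℝ) : EReal) ≤ kl u v := by
  by_cases h : (v = 0 ∧ u ≠ 0) ∨ (v = 1 ∧ u ≠ 1)
  · unfold kl; rw [if_pos h]; exact le_top
  · by_cases h2 : u = v
    · subst h2; rw [kl_self]; simp
    · rw [kl_eq_coe (by tauto) (by tauto)]
      have h3 : v ≠ 0 := by rintro rfl; tauto
      have h4 : v ≠ 1 := by rintro rfl; tauto
      exact_mod_cast two_mul_sq_le_klR hu ⟨hv.1.lt_of_ne' h3, hv.2.lt_of_ne h4⟩

/-- The divergence of `u` from `v` if `u` deviates downwards from `v < 1`, and `0` otherwise. -/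
def dev (u v : ℝ) : ℝ := open Classical in if u < v ∧ v < 1 then klR u v else 0

lemma dev_nonneg {u v : ℝ} (hu : 0 ≤ u) : 0 ≤ dev u v := by
  unfold dev
  split_ifs with h
  · exact le_trans (by positivity) (klR_ge_of_le hu h.1.le h.2)
  · rfl

/-! ### The exploration function and the comparison of the two indexes -/

/-- `f` as a real number, for `n ≥ 2`. -/
def fR (m n : ℕ) : ℝ := Real.log n + 4 * m * Real.log (Real.log n)

lemma f_eq_coe (m : ℕ) {n : ℕ} (hn : 2 ≤ n) : f m n = (fR m n : EReal) := by
  unfold f fR; rw [if_neg (by omega)]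

lemma one_le_log {n : ℕ} (hn : 3 ≤ n) : 1 ≤ Real.log n := by
  rw [Real.le_log_iff_exp_le (by positivity)]
  have : (3 : ℝ) ≤ n := by exact_mod_cast hn
  linarith [Real.exp_one_lt_d9]

lemma log_le_fR (m : ℕ) {n : ℕ} (hn : 3 ≤ n) : Real.log n ≤ fR m n := by
  unfold fR
  have := Real.log_nonneg (one_le_log hn)
  have : 0 ≤ 4 * (m : ℝ) * Real.log (Real.log n) := by positivity
  linarith

lemma fR_two_neg {m : ℕ} (hm : 1 ≤ m) : fR m 2 < 0 := by
  unfold fR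
  have h1 := Real.log_two_lt_d9
  have h2 : Real.log (Real.log 2) ≤ Real.log 2 - 1 :=
    Real.log_le_sub_one_of_pos (Real.log_pos (by norm_num))
  have h3 : (1 : ℝ) ≤ m := by exact_mod_cast hm
  push_cast
  nlinarith

lemma fR_ne_zero {m n : ℕ} (hm : 1 ≤ m) (hn : 2 ≤ n) : fR m n ≠ 0 := by
  rcases hn.eq_or_lt with h | h
  · subst h; exact (fR_two_neg hm).ne
  · have := log_le_fR m h; have := one_le_log h
    linarith

lemma coe_finset_sum {ι : Type*} (s : Finset ι) (g : ι → ℝ) :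
    ((∑ i ∈ s, g i : ℝ) : EReal) = ∑ i ∈ s, (g i : EReal) := by
  classical
  induction s using Finset.induction_on with
  | empty => simp
  | insert a s ha ih => rw [Finset.sum_insert ha, Finset.sum_insert ha, EReal.coe_add, ih]

lemma natCast_mul_coe (k : ℕ) (x : ℝ) : (k : EReal) * (x : EReal) = ((k * x : ℝ) : EReal) := by
  rw [EReal.coe_mul]; rfl

lemma sum_sq_le_of_feasible {d m n : ℕ} {t : Fin d → ℕ} {τ q : Fin d → ℝ}
    {M : Finset (Fin d)} (hn : 2 ≤ n) (hτ : ∀ i, τ i ∈ Set.Icc (0 : ℝ) 1)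
    (hq : q ∈ feasible m n t τ M) :
    ∑ i ∈ M, t i * (2 * (τ i - q i) ^ 2) ≤ fR m n := by
  have h := hq.2
  rw [f_eq_coe m hn] at h
  have h2 : ((∑ i ∈ M, t i * (2 * (τ i - q i) ^ 2) : ℝ) : EReal)
      ≤ ∑ i ∈ M, (t i : EReal) * kl (τ i) (q i) := by
    rw [coe_finset_sum]
    refine Finset.sum_le_sum fun i _ => ?_
    rw [← natCast_mul_coe]
    exact mul_le_mul_of_nonneg_left (two_mul_sq_le_kl (hτ i) (hq.1 i)) (by positivity)
  exact_mod_cast h2.trans h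

lemma dot_sub_le_sqrt {d : ℕ} {t : Fin d → ℕ} {τ q : Fin d → ℝ} {M : Finset (Fin d)} {F : ℝ}
    (ht : ∀ i ∈ M, t i ≠ 0) (h : ∑ i ∈ M, t i * (2 * (τ i - q i) ^ 2) ≤ F) :
    dot M q - dot M τ ≤ Real.sqrt (F / 2 * ∑ i ∈ M, (t i : ℝ)⁻¹) := by
  apply Real.le_sqrt_of_sq_le
  have hcs := Finset.sum_mul_sq_le_sq_mul_sq M
    (fun i => Real.sqrt (t i) * (q i - τ i)) (fun i => (Real.sqrt (t i))⁻¹)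
  have e1 : ∑ i ∈ M, Real.sqrt (t i) * (q i - τ i) * (Real.sqrt (t i))⁻¹ = dot M q - dot M τ := by
    unfold dot
    rw [← Finset.sum_sub_distrib]
    refine Finset.sum_congr rfl fun i hi => ?_
    have : Real.sqrt (t i) ≠ 0 := by
      have := ht i hi
      positivity
    field_simp
  have e2 : ∑ i ∈ M, (Real.sqrt (t i) * (q i - τ i)) ^ 2
      = (∑ i ∈ M, t i * (2 * (τ i - q i) ^ 2)) / 2 := by
    rw [Finset.sum_div]
    refine Finset.sum_congr rfl fun i hi => ?_
    rw [mul_pow, Real.sq_sqrt (by positivity)]; ring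
  have e3 : ∑ i ∈ M, ((Real.sqrt (t i))⁻¹) ^ 2 = ∑ i ∈ M, (t i : ℝ)⁻¹ := by
    refine Finset.sum_congr rfl fun i hi => ?_
    rw [inv_pow, Real.sq_sqrt (by positivity)]
  rw [e1, e2, e3] at hcs
  refine hcs.trans (mul_le_mul_of_nonneg_right (by linarith) ?_)
  positivity

lemma c_eq_coe {d m n : ℕ} {t : Fin d → ℕ} {τ : Fin d → ℝ} {M : Finset (Fin d)} (hn : 2 ≤ n)
    (hf : 0 ≤ fR m n) (ht : ∀ i ∈ M, t i ≠ 0) :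
    c m n t τ M = ((dot M τ + Real.sqrt (fR m n / 2 * ∑ i ∈ M, (t i : ℝ)⁻¹) : ℝ) : EReal) := by
  have h1 : (∑ i ∈ M, (t i : ℝ≥0∞)⁻¹) = ENNReal.ofReal (∑ i ∈ M, (t i : ℝ)⁻¹) := by
    rw [ENNReal.ofReal_sum_of_nonneg (fun i _ => by positivity)]
    refine Finset.sum_congr rfl fun i hi => ?_
    have : (0 : ℝ) < t i := by have := ht i hi; positivity
    rw [ENNReal.ofReal_inv_of_pos this, ENNReal.ofReal_natCast]
  have h2 : (f m n).toENNReal = ENNReal.ofReal (fR m n) := by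
    rw [f_eq_coe m hn, EReal.toENNReal_of_ne_top (by simp)]; simp
  have h3 : (2 : ℝ≥0∞) = ENNReal.ofReal 2 := by simp
  unfold c
  rw [h1, h2, h3, ← ENNReal.ofReal_div_of_pos (by norm_num), ← ENNReal.ofReal_mul (by positivity),
    ENNReal.ofReal_rpow_of_nonneg (by positivity) (by norm_num), ← Real.sqrt_eq_rpow,
    EReal.coe_add, EReal.coe_ennreal_ofReal, max_eq_left (Real.sqrt_nonneg _)]

/-- Strict positivity of `f(n)` matters: at `f(n) = 0` the convention `0 * ∞ = 0` would make the
index finite. -/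
lemma c_eq_top {d m n : ℕ} {t : Fin d → ℕ} {τ : Fin d → ℝ} {M : Finset (Fin d)} (hn : 2 ≤ n)
    (hf : 0 < fR m n) (ht : ∃ i ∈ M, t i = 0) : c m n t τ M = ⊤ := by
  obtain ⟨i, hi, h0⟩ := ht
  have h1 : (∑ i ∈ M, (t i : ℝ≥0∞)⁻¹) = ⊤ := by
    rw [ENNReal.sum_eq_top]
    exact ⟨i, hi, by simp [h0]⟩
  have h2 : (f m n).toENNReal = ENNReal.ofReal (fR m n) := by
    rw [f_eq_coe m hn, EReal.toENNReal_of_ne_top (by simp)]; simp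
  unfold c
  rw [h1, h2, ENNReal.mul_top, ENNReal.top_rpow_of_pos (by norm_num)]
  · simp
  · simp [hf]

theorem b_le_c {d m : ℕ} {M : Finset (Fin d)} (hM : M.card = m) {n : ℕ} (hn : 1 ≤ n)
    (t : Fin d → ℕ) {τ : Fin d → ℝ} (hτ : ∀ i, τ i ∈ Set.Icc (0 : ℝ) 1) :
    b m n t τ M ≤ c m n t τ M := by
  refine iSup₂_le fun q hq => ?_
  rcases hn.eq_or_lt with h1 | hn
  -- For `n = 1` nothing is feasible, since a sum of nonnegative terms is not `-∞`.
  · exfalso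
    have h := hq.2
    rw [← h1, show f m 1 = ⊥ by simp [f], le_bot_iff] at h
    have : (0 : EReal) ≤ ∑ i ∈ M, (t i : EReal) * kl (τ i) (q i) := by
      refine Finset.sum_nonneg fun i _ => mul_nonneg (by positivity) ?_
      refine le_trans ?_ (two_mul_sq_le_kl (hτ i) (hq.1 i))
      exact_mod_cast (by positivity)
    rw [h] at this
    simp at this
  have hs := sum_sq_le_of_feasible hn hτ hq
  have hf : 0 ≤ fR m n := le_trans (Finset.sum_nonneg fun i _ => by positivity) hs
  by_cases ht : ∃ i ∈ M, t i = 0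
  -- An unsampled action in `M` gives `m ≥ 1`, which excludes `f(n) = 0`.
  · have hm : 1 ≤ m := by
      obtain ⟨i, hi, _⟩ := ht
      rw [← hM]; exact Finset.card_pos.2 ⟨i, hi⟩
    rw [c_eq_top hn (hf.lt_of_ne' (fR_ne_zero hm hn)) ht]
    exact le_top
  · push Not at ht
    rw [c_eq_coe hn hf ht]
    have := dot_sub_le_sqrt ht hs
    exact_mod_cast (by linarith)

/-! ### Lower bounds for the index -/

/-- The witness is `max u v`, except that without samples `v` itself is free of cost. The hypothesis
`h1` excludes infinite divergence at `v = 1`. -/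
lemma exists_le_of_dev {u v : ℝ} (hu : u ∈ Set.Icc (0 : ℝ) 1) (hv : v ∈ Set.Icc (0 : ℝ) 1) (k : ℕ)
    (h1 : k ≠ 0 → v = 1 → u = 1) :
    ∃ q ∈ Set.Icc (0 : ℝ) 1, v ≤ q ∧ (k : EReal) * kl u q ≤ ((k * dev u v : ℝ) : EReal) := by
  by_cases hk : k = 0
  · exact ⟨v, hv, le_rfl, by simp [hk]⟩
  by_cases huv : v ≤ u
  · refine ⟨u, hu, huv, ?_⟩
    have := dev_nonneg (v := v) hu.1
    rw [kl_self, mul_zero]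
    exact_mod_cast (by positivity)
  · push Not at huv
    have hv1 : v ≠ 1 := fun h => by have := h1 hk h; linarith
    refine ⟨v, hv, le_rfl, ?_⟩
    rw [kl_eq_coe (fun h => by linarith [hu.1]) (fun h => absurd h hv1), natCast_mul_coe]
    unfold dev
    rw [if_pos ⟨huv, hv.2.lt_of_ne hv1⟩]

lemma continuousAt_klR {u v : ℝ} (hu0 : 0 ≤ u) (huv : u ≤ v) (hv : v < 1) :
    ContinuousAt (klR u) v := by
  unfold klR
  have h2 : ContinuousAt (fun x => (1 - u) * Real.log ((1 - u) / (1 - x))) v := by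
    refine continuousAt_const.mul (ContinuousAt.log (ContinuousAt.div (by fun_prop) (by fun_prop) ?_) ?_)
    · linarith
    · have : 0 < (1 - u) / (1 - v) := div_pos (by linarith) (by linarith)
      exact this.ne'
  have h1 : ContinuousAt (fun x => u * Real.log (u / x)) v := by
    rcases hu0.eq_or_lt with h | h
    · subst h; simpa using continuousAt_const
    · refine continuousAt_const.mul (ContinuousAt.log (ContinuousAt.div (by fun_prop) (by fun_prop) ?_) ?_)
      · linarith
      · have : 0 < u / v := div_pos h (by linarith)
        exact this.ne'
  exact h1.add h2

/-- When `u ≤ v < 1`, right-continuity of the divergence at `v` leaves room for a point slightly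
above `v` at extra cost `ε`. -/
lemma exists_lt_of_dev {u v : ℝ} (hu : u ∈ Set.Icc (0 : ℝ) 1) (hv : v ∈ Set.Icc (0 : ℝ) 1) (k : ℕ)
    (hv1 : v ≠ 1) {ε : ℝ} (hε : 0 < ε) :
    ∃ q ∈ Set.Icc (0 : ℝ) 1, v < q ∧ (k : EReal) * kl u q ≤ ((k * dev u v + ε : ℝ) : EReal) := by
  have hv1' : v < 1 := hv.2.lt_of_ne hv1
  by_cases huv : v < u
  · refine ⟨u, hu, huv, ?_⟩
    have := dev_nonneg (v := v) hu.1
    rw [kl_self, mul_zero]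
    exact_mod_cast (by positivity)
  push Not at huv
  have hd : dev u v = klR u v := by
    unfold dev
    rcases huv.eq_or_lt with h | h
    · subst h; simp [klR_self]
    · rw [if_pos ⟨h, hv1'⟩]
  have hc : ContinuousAt (fun x => k * klR u x) v :=
    continuousAt_const.mul (continuousAt_klR hu.1 huv hv1')
  have h1 : ∀ᶠ x in nhdsWithin v (Set.Ioi v), k * klR u x < k * klR u v + ε :=
    (hc.tendsto.mono_left nhdsWithin_le_nhds).eventually_lt_const (by linarith)
  have h2 : ∀ᶠ x in nhdsWithin v (Set.Ioi v), x < 1 :=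
    (Filter.tendsto_id.mono_left nhdsWithin_le_nhds).eventually_lt_const hv1'
  obtain ⟨q, hq1, hq2, hq3⟩ := (h1.and (h2.and self_mem_nhdsWithin)).exists
  have hq3 : v < q := hq3
  refine ⟨q, ⟨by linarith [hv.1], hq2.le⟩, hq3, ?_⟩
  rw [kl_eq_coe (fun h => by linarith [hv.1]) (fun h => by linarith), natCast_mul_coe, hd]
  exact_mod_cast hq1.le

lemma dot_le_b {d m n : ℕ} {t : Fin d → ℕ} {τ q : Fin d → ℝ} {M : Finset (Fin d)} {e : Fin d → ℝ}
    (hn : 2 ≤ n) (hq : ∀ i, q i ∈ Set.Icc (0 : ℝ) 1)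
    (h : ∀ i ∈ M, (t i : EReal) * kl (τ i) (q i) ≤ (e i : EReal)) (he : ∑ i ∈ M, e i ≤ fR m n) :
    ((dot M q : ℝ) : EReal) ≤ b m n t τ M := by
  refine le_iSup₂_of_le q ⟨hq, ?_⟩ le_rfl
  rw [f_eq_coe m hn]
  refine (Finset.sum_le_sum h).trans ?_
  rw [← coe_finset_sum]
  exact_mod_cast he

/-- If the total downward deviation is below `f(n)`, the index does not underestimate. -/
lemma meanReward_le_b {d m n : ℕ} {t : Fin d → ℕ} {τ : Fin d → ℝ} {M : Finset (Fin d)}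
    {θ : Fin d → unitInterval} (hn : 2 ≤ n) (hτ : ∀ i, τ i ∈ Set.Icc (0 : ℝ) 1)
    (h1 : ∀ i, t i ≠ 0 → (θ i : ℝ) = 1 → τ i = 1)
    (h : ∑ i ∈ M, t i * dev (τ i) (θ i) < fR m n) : meanReward θ M ≤ b m n t τ M := by
  choose q hq hle hkl using fun i => exists_le_of_dev (hτ i) (θ i).2 (t i) (h1 i)
  refine le_trans ?_ (dot_le_b hn hq (fun i _ => hkl i) h.le)
  unfold meanReward
  exact_mod_cast Finset.sum_le_sum fun i _ => hle i

lemma meanReward_lt_b {d m n : ℕ} {t : Fin d → ℕ} {τ : Fin d → ℝ} {M : Finset (Fin d)}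
    {θ : Fin d → unitInterval} (hn : 2 ≤ n) (hτ : ∀ i, τ i ∈ Set.Icc (0 : ℝ) 1)
    (h1 : ∀ i, t i ≠ 0 → (θ i : ℝ) = 1 → τ i = 1) (hθ : ∃ i ∈ M, θ i ≠ 1)
    (h : ∑ i ∈ M, t i * dev (τ i) (θ i) < fR m n) : meanReward θ M < b m n t τ M := by
  choose q hq hle hkl using fun i => exists_le_of_dev (hτ i) (θ i).2 (t i) (h1 i)
  obtain ⟨j, hj, hj1⟩ := hθ
  obtain ⟨p, hp, hlt, hpkl⟩ := exists_lt_of_dev (hτ j) (θ j).2 (t j)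
    (fun h => hj1 (Subtype.ext h)) (sub_pos.2 h)
  -- The whole slack below `f(n)` is spent on the single coordinate `j`.
  refine lt_of_lt_of_le ?_ (dot_le_b (q := Function.update q j p)
    (e := fun i => t i * dev (τ i) (θ i) +
      if i = j then (fR m n - ∑ i ∈ M, t i * dev (τ i) (θ i)) else 0) hn ?_ ?_ ?_)
  · unfold meanReward
    refine EReal.coe_lt_coe_iff.2 (Finset.sum_lt_sum (fun i _ => ?_) ⟨j, hj, by simpa using hlt⟩)
    by_cases hij : i = j
    · subst hij; simpa using hlt.le
    · simpa [hij] using hle i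
  · intro i
    by_cases hij : i = j
    · subst hij; simpa using hp
    · simpa [hij] using hq i
  · intro i _
    by_cases hij : i = j
    · subst hij; simpa using hpkl
    · simpa [hij] using hkl i
  · rw [Finset.sum_add_distrib, Finset.sum_ite_eq' M j, if_pos hj]
    linarith

/-! ### Likelihood ratio tests -/

/-- Rewriting through `x log x` gives continuity also at the endpoints `u = 0` and `u = 1`. -/
lemma continuous_klR_left {v : ℝ} (h0 : v ≠ 0) (h1 : v ≠ 1) : Continuous fun u => klR u v := by
  have h1' : 1 - v ≠ 0 := sub_ne_zero.2 h1.symm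
  have h : (fun u => klR u v) = fun u => v * (u / v * Real.log (u / v))
      + (1 - v) * ((1 - u) / (1 - v) * Real.log ((1 - u) / (1 - v))) := by
    ext u; unfold klR; field_simp
  rw [h]
  have e1 : Continuous fun u : ℝ => u / v * Real.log (u / v) :=
    Real.continuous_mul_log.comp (by fun_prop : Continuous fun u : ℝ => u / v)
  have e2 : Continuous fun u : ℝ => (1 - u) / (1 - v) * Real.log ((1 - u) / (1 - v)) :=
    Real.continuous_mul_log.comp (by fun_prop : Continuous fun u : ℝ => (1 - u) / (1 - v))
  fun_prop

lemma lintegral_bernoulliMeasure (θ : unitInterval) (g : ℝ → ℝ≥0∞) :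
    ∫⁻ x, g x ∂(bernoulliMeasure (1 : ℝ) 0 θ)
      = ENNReal.ofReal θ * g 1 + ENNReal.ofReal (1 - θ) * g 0 := by
  have e1 : ((unitInterval.toNNReal θ : NNReal) : ℝ≥0∞) = ENNReal.ofReal θ := by
    rw [← ENNReal.ofReal_coe_nnreal]; rfl
  have e2 : ((unitInterval.toNNReal (unitInterval.symm θ) : NNReal) : ℝ≥0∞)
      = ENNReal.ofReal (1 - θ) := by
    rw [← ENNReal.ofReal_coe_nnreal]; rfl
  rw [bernoulliMeasure_def, lintegral_add_measure, lintegral_smul_measure, lintegral_smul_measure,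
    lintegral_dirac, lintegral_dirac, ENNReal.smul_def, ENNReal.smul_def, e1, e2]
  rfl

/-- For each level `a`, a likelihood ratio of Bernoulli laws detects all empirical means that deviate
downwards from `θ` by more than `a`. -/
lemma exists_test (θ : unitInterval) {a : ℝ} (ha : 0 ≤ a) :
    ∃ g : ℝ → ℝ≥0∞, Measurable g ∧ ∫⁻ x, g x ∂(bernoulliMeasure (1 : ℝ) 0 θ) ≤ 1 ∧
      ∀ (T : Finset ℕ) (x : ℕ → ℝ), (∀ s ∈ T, x s ∈ Set.Icc (0 : ℝ) 1) →
        a < dev ((∑ s ∈ T, x s) / T.card) θ →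
        ENNReal.ofReal (Real.exp (T.card * a)) ≤ ∏ s ∈ T, g (x s) := by
  have hmean : ∀ (T : Finset ℕ) (x : ℕ → ℝ), (∀ s ∈ T, x s ∈ Set.Icc (0 : ℝ) 1) →
      0 ≤ (∑ s ∈ T, x s) / T.card := fun T x hx =>
    div_nonneg (Finset.sum_nonneg fun s hs => (hx s hs).1) (by positivity)
  -- If no mean deviates by more than `a`, the constant test 1 works vacuously.
  by_cases hex : ∃ p, 0 ≤ p ∧ a < dev p θ
  swap
  · push Not at hex
    refine ⟨fun _ => 1, measurable_const, by simp, fun T x hx h => ?_⟩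
    exact absurd h (not_lt.2 (hex _ (hmean T x hx)))
  obtain ⟨p, hp0, hpa⟩ := hex
  have hdev : ∀ p, a < dev p θ → p < θ ∧ (θ : ℝ) < 1 ∧ a < klR p θ := by
    intro p hp
    unfold dev at hp
    split_ifs at hp with h
    · exact ⟨h.1, h.2, hp⟩
    · linarith
  obtain ⟨hpθ, hθ1, hpk⟩ := hdev p hpa
  have hθ0 : (0 : ℝ) < θ := by linarith
  obtain ⟨q, hq, hqa⟩ := intermediate_value_Icc' hpθ.le
    (continuous_klR_left hθ0.ne' hθ1.ne).continuousOn (show a ∈ Set.Icc (klR θ θ) (klR p θ) from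
      ⟨by rw [klR_self]; exact ha, hpk.le⟩)
  have hqa : klR q θ = a := hqa
  have hq0 : 0 < q := by
    rcases hq.1.eq_or_lt with h | h
    · subst h; linarith
    · linarith
  have hqθ : q ≤ θ := hq.2
  set α := Real.log (q / θ) with hα
  set β := Real.log ((1 - q) / (1 - θ)) with hβ
  have hα0 : α ≤ 0 := Real.log_nonpos (by positivity) ((div_le_one hθ0).2 hqθ)
  have hβ0 : 0 ≤ β := Real.log_nonneg ((one_le_div (by linarith)).2 (by linarith))
  -- On `{0, 1}` this is the likelihood ratio of mean `q` against mean `θ`; its logarithm is affine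
  -- in `x`, so a product over samples depends only on their number and mean.
  refine ⟨fun x => ENNReal.ofReal (Real.exp (x * α + (1 - x) * β)), by fun_prop, ?_, ?_⟩
  · rw [lintegral_bernoulliMeasure]
    simp only [one_mul, sub_self, zero_mul, add_zero, sub_zero, zero_add]
    rw [Real.exp_log (by positivity), Real.exp_log (div_pos (by linarith) (by linarith)),
      ← ENNReal.ofReal_mul hθ0.le, ← ENNReal.ofReal_mul (by linarith),
      ← ENNReal.ofReal_add (mul_nonneg hθ0.le (by positivity))
        (mul_nonneg (by linarith) (div_nonneg (by linarith) (by linarith)))]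
    rw [mul_div_cancel₀ _ hθ0.ne', mul_div_cancel₀ _ (by linarith)]
    simp
  · intro T x hx hT
    obtain ⟨h1, -, h2⟩ := hdev _ hT
    set μ := (∑ s ∈ T, x s) / T.card with hμ
    have hμq : μ ≤ q := by
      by_contra! h
      have := klR_anti hq0 h.le h1.le hθ1
      linarith
    rw [← ENNReal.ofReal_prod_of_nonneg (fun s _ => (Real.exp_pos _).le), ← Real.exp_sum]
    refine ENNReal.ofReal_le_ofReal (Real.exp_le_exp.2 ?_)
    have hS : ∑ s ∈ T, x s = T.card * μ := by
      rcases T.eq_empty_or_nonempty with h | h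
      · simp [h]
      · have : (T.card : ℝ) ≠ 0 := by exact_mod_cast (Finset.card_pos.2 h).ne'
        rw [hμ]; field_simp
    have hsum : ∑ s ∈ T, (x s * α + (1 - x s) * β) = T.card * (μ * α + (1 - μ) * β) := by
      have : ∀ s ∈ T, x s * α + (1 - x s) * β = x s * (α - β) + β := fun s _ => by ring
      rw [Finset.sum_congr rfl this, Finset.sum_add_distrib, ← Finset.sum_mul, hS]
      simp
      ring
    rw [hsum, ← hqa]
    refine mul_le_mul_of_nonneg_left ?_ (Nat.cast_nonneg _)
    unfold klR
    rw [← hα, ← hβ]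
    -- As `α ≤ 0 ≤ β`, the average log-ratio decreases in the mean; at mean `q` it equals `klR q θ =
    -- a`.
    nlinarith [mul_nonneg (sub_nonneg.2 hμq) (sub_nonneg.2 (hα0.trans hβ0))]

/-- A geometric grid of levels of size `O(δ²)`. -/
lemma exists_levels {δ : ℝ} {n : ℕ} (hn : 1 ≤ n) (hδ : 1 ≤ δ) (hnδ : Real.log n ≤ δ) :
    ∃ (K : ℕ) (lev : Fin K → ℝ), (K + 1 : ℝ) ≤ 7 * δ ^ 2 ∧ (∀ k, 0 ≤ lev k) ∧
      ∀ (t : ℕ) (x : ℝ), t ≤ n → t * x ≤ 1 ∨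
        ∃ k, lev k < x ∧ min (t * x) δ - 1 ≤ t * lev k := by
  have hδ0 : 0 < δ := by linarith
  have hn0 : (0 : ℝ) < n := by exact_mod_cast hn
  set r : ℝ := 1 + 1 / δ with hr
  have hr0 : 0 < r := by positivity
  set K₀ : ℕ := ⌈2 * δ * (δ + 1)⌉₊ with hK₀
  have htop : δ ≤ r ^ K₀ / n := by
    rw [le_div_iff₀ hn0, ← Real.log_le_log_iff (by positivity) (by positivity),
      Real.log_mul hδ0.ne' hn0.ne', Real.log_pow]
    have h1 : 1 / (δ + 1) ≤ Real.log r := by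
      have := Real.one_sub_inv_le_log_of_pos hr0
      have e : 1 - r⁻¹ = 1 / (δ + 1) := by rw [hr]; field_simp; ring
      rwa [e] at this
    have h2 : 2 * δ * (δ + 1) ≤ K₀ := Nat.le_ceil _
    have h3 : Real.log δ ≤ δ := by linarith [Real.log_le_sub_one_of_pos hδ0]
    calc Real.log δ + Real.log n ≤ 2 * δ := by linarith
      _ = 2 * δ * (δ + 1) * (1 / (δ + 1)) := by field_simp
      _ ≤ K₀ * Real.log r := mul_le_mul h2 h1 (by positivity) (by positivity)
  refine ⟨K₀ + 1, fun k => r ^ (k : ℕ) / n, ?_, fun k => by positivity, fun t x ht => ?_⟩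
  · have : (K₀ : ℝ) < 2 * δ * (δ + 1) + 1 := Nat.ceil_lt_add_one (by positivity)
    push_cast
    nlinarith
  by_cases htx : t * x ≤ 1
  · exact Or.inl htx
  refine Or.inr ?_
  push Not at htx
  have ht1 : 1 ≤ t := by
    by_contra! h
    have : t = 0 := by omega
    subst this; norm_num at htx
  have ht1' : (1 : ℝ) ≤ t := by exact_mod_cast ht1
  have htn : (t : ℝ) ≤ n := by exact_mod_cast ht
  by_cases hx : r ^ K₀ / n < x
  · refine ⟨Fin.last _, by simpa using hx, ?_⟩
    simp only [Fin.val_last]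
    have : min (t * x) δ ≤ δ := min_le_right _ _
    nlinarith
  push Not at hx
  have hx0 : 0 < x := by
    by_contra! h
    nlinarith
  have hex : ∃ k, x ≤ r ^ k / n := ⟨K₀, hx⟩
  classical
  obtain ⟨hk1, hk2⟩ : x ≤ r ^ (Nat.find hex) / n ∧ ∀ j < Nat.find hex, ¬ x ≤ r ^ j / n :=
    ⟨Nat.find_spec hex, fun j hj => Nat.find_min hex hj⟩
  have hkK : Nat.find hex ≤ K₀ := Nat.find_min' hex hx
  -- The bottom level `1 / n` is already below `x`, because `t x > 1` and `t ≤ n`.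
  obtain ⟨j, hj⟩ : ∃ j, Nat.find hex = j + 1 := by
    refine Nat.exists_eq_succ_of_ne_zero fun h0 => ?_
    rw [h0, pow_zero, le_div_iff₀ hn0] at hk1
    nlinarith
  rw [hj] at hk1 hk2 hkK
  refine ⟨⟨j, by omega⟩, not_le.1 (hk2 j (by omega)), ?_⟩
  simp only
  set l := r ^ j / n with hl
  have hxl : x ≤ r * l := by rw [hl, pow_succ] at *; rw [← mul_div_assoc, mul_comm r]; exact hk1
  have hl0 : 0 < l := by positivity
  -- Rounding down one grid step costs a factor `1 + 1 / δ`, hence at most 1 once `t x` is truncated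
  -- at `δ`.
  have h1 : t * x * δ ≤ (δ + 1) * (t * l) := by
    have : t * x ≤ t * (r * l) := by gcongr
    calc t * x * δ ≤ t * (r * l) * δ := by gcongr
      _ = (δ + 1) * (t * l) := by rw [hr]; field_simp
  set y := t * x
  set z := t * l
  rcases le_total y δ with h | h
  · rw [min_eq_left h]; nlinarith
  · rw [min_eq_right h]; nlinarith

/-- The index `none` is the trivial test, enough when `t x ≤ 1`. The number `K` is chosen before
`θ`, so that all actions of an arm share one index set. -/
lemma exists_tests {δ : ℝ} {n : ℕ} (hn : 1 ≤ n) (hδ : 1 ≤ δ) (hnδ : Real.log n ≤ δ) :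
    ∃ K : ℕ, (K + 1 : ℝ) ≤ 7 * δ ^ 2 ∧ ∀ θ : unitInterval, ∃ g : Option (Fin K) → ℝ → ℝ≥0∞,
      (∀ k, Measurable (g k)) ∧ (∀ k, ∫⁻ x, g k x ∂(bernoulliMeasure (1 : ℝ) 0 θ) ≤ 1) ∧
      ∀ (T : Finset ℕ) (x : ℕ → ℝ), T.card ≤ n → (∀ s ∈ T, x s ∈ Set.Icc (0 : ℝ) 1) →
        ∃ k, ENNReal.ofReal (Real.exp (min (T.card * dev ((∑ s ∈ T, x s) / T.card) θ) δ - 1))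
          ≤ ∏ s ∈ T, g k (x s) := by
  obtain ⟨K, lev, hK, hlev, hgrid⟩ := exists_levels hn hδ hnδ
  refine ⟨K, hK, fun θ => ?_⟩
  choose g hg1 hg2 hg3 using fun k => exists_test θ (hlev k)
  refine ⟨fun k => k.elim (fun _ => 1) g, ?_, ?_, fun T x hT hx => ?_⟩
  · rintro (_ | k)
    · exact measurable_const
    · exact hg1 k
  · rintro (_ | k)
    · simp
    · exact hg2 k
  · rcases hgrid T.card (dev ((∑ s ∈ T, x s) / T.card) θ) hT with h | ⟨k, hk, hk'⟩
    · refine ⟨none, ?_⟩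
      simp only [Option.elim_none, Finset.prod_const_one]
      rw [ENNReal.ofReal_le_one, Real.exp_le_one_iff]
      linarith [min_le_left (T.card * dev ((∑ s ∈ T, x s) / T.card) θ) δ]
    · exact ⟨some k, (ENNReal.ofReal_le_ofReal (Real.exp_le_exp.2 hk')).trans (hg3 k T x hx hk)⟩

/-! ### The likelihood ratio process of a policy -/

/-- The intersections `a ∩ b` form a π-system generating `m₁ ⊔ m₂`; on them the two hypotheses are
applied in turn. In the application `m₁` is the seed, `m₂` the past rewards and `m₃` the present
ones. -/
lemma indep_sup_left_of_indep {Ω : Type*} {m₁ m₂ m₃ mΩ : MeasurableSpace Ω} {P : Measure Ω}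
    [IsProbabilityMeasure P] (h₁ : m₁ ≤ mΩ) (h₂ : m₂ ≤ mΩ) (h₃ : m₃ ≤ mΩ)
    (h : Indep m₁ (m₂ ⊔ m₃) P) (h' : Indep m₂ m₃ P) : Indep (m₁ ⊔ m₂) m₃ P := by
  let p : Set (Set Ω) := {s | ∃ a b, MeasurableSet[m₁] a ∧ MeasurableSet[m₂] b ∧ a ∩ b = s}
  have hp : IsPiSystem p := by
    rintro _ ⟨a, b, ha, hb, rfl⟩ _ ⟨a', b', ha', hb', rfl⟩ _
    exact ⟨a ∩ a', b ∩ b', ha.inter ha', hb.inter hb', Set.inter_inter_inter_comm a a' b b'⟩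
  have hpm : ∀ s ∈ p, MeasurableSet[mΩ] s := by
    rintro _ ⟨a, b, ha, hb, rfl⟩
    exact (h₁ _ ha).inter (h₂ _ hb)
  have hind : IndepSets p {s | MeasurableSet[m₃] s} P := by
    rw [IndepSets_iff]
    rintro _ c ⟨a, b, ha, hb, rfl⟩ hc
    rw [Indep_iff] at h h'
    have e2 : MeasurableSet[m₂ ⊔ m₃] b := (le_sup_left : m₂ ≤ m₂ ⊔ m₃) _ hb
    have e3 : MeasurableSet[m₂ ⊔ m₃] c := (le_sup_right : m₃ ≤ m₂ ⊔ m₃) _ hc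
    rw [Set.inter_assoc, h _ _ ha (MeasurableSet.inter e2 e3), h' _ _ hb hc, h _ _ ha e2, mul_assoc]
  have key : Indep (MeasurableSpace.generateFrom p)
      (MeasurableSpace.generateFrom {s | MeasurableSet[m₃] s}) P :=
    IndepSets.indep' hpm h₃ hp (@MeasurableSpace.isPiSystem_measurableSet Ω m₃) hind
  rw [@MeasurableSpace.generateFrom_measurableSet Ω m₃] at key
  refine indep_of_indep_of_le_left key (sup_le ?_ ?_)
  · intro a ha
    exact MeasurableSpace.measurableSet_generateFrom
      ⟨a, Set.univ, ha, MeasurableSet.univ, Set.inter_univ a⟩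
  · intro b hb
    exact MeasurableSpace.measurableSet_generateFrom
      ⟨Set.univ, b, MeasurableSet.univ, hb, Set.univ_inter b⟩

/-- The σ-algebra generated by the randomization and by all rewards before index `s`. -/
@[reducible] def past {d : ℕ} {Ω S : Type*} [MeasurableSpace S] (U : Ω → S)
    (X : ℕ → Fin d → Ω → ℝ) (s : ℕ) : MeasurableSpace Ω :=
  MeasurableSpace.comap U inferInstance ⊔
    ⨆ p ∈ {p : ℕ × Fin d | p.1 < s}, MeasurableSpace.comap (X p.1 p.2) inferInstance

/-- The σ-algebra generated by the rewards at index `s`. -/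
@[reducible] def present {d : ℕ} {Ω : Type*} (X : ℕ → Fin d → Ω → ℝ) (s : ℕ) :
    MeasurableSpace Ω :=
  ⨆ p ∈ {p : ℕ × Fin d | p.1 = s}, MeasurableSpace.comap (X p.1 p.2) inferInstance

section

variable {d : ℕ} {Ω S : Type*} [MeasurableSpace S] {U : Ω → S} {X : ℕ → Fin d → Ω → ℝ}
  {A : ℕ → Ω → Finset (Fin d)} {ℳ : Finset (Finset (Fin d))}

lemma past_mono {r s : ℕ} (h : r ≤ s) : past U X r ≤ past U X s := by
  refine sup_le_sup le_rfl (iSup₂_le fun p hp => ?_)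
  exact le_iSup₂_of_le (f := fun (p : ℕ × Fin d) (_ : p ∈ {p : ℕ × Fin d | p.1 < s}) =>
    MeasurableSpace.comap (X p.1 p.2) inferInstance) p (lt_of_lt_of_le hp h) le_rfl

lemma measurable_past {r s : ℕ} (h : r < s) (i : Fin d) : Measurable[past U X s] (X r i) := by
  rw [measurable_iff_comap_le]
  refine le_trans ?_ le_sup_right
  exact le_iSup₂_of_le (f := fun (p : ℕ × Fin d) (_ : p ∈ {p : ℕ × Fin d | p.1 < s}) =>
    MeasurableSpace.comap (X p.1 p.2) inferInstance) (r, i) h le_rfl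

lemma measurable_present (s : ℕ) (i : Fin d) : Measurable[present X s] (X s i) := by
  rw [measurable_iff_comap_le]
  exact le_iSup₂_of_le (f := fun (p : ℕ × Fin d) (_ : p ∈ {p : ℕ × Fin d | p.1 = s}) =>
    MeasurableSpace.comap (X p.1 p.2) inferInstance) (s, i) rfl le_rfl

/-- The product over the rounds `1, …, n` and the sampled actions in `M` of the values of the test
functions `g i`. -/
def ratio (X : ℕ → Fin d → Ω → ℝ) (A : ℕ → Ω → Finset (Fin d)) (M : Finset (Fin d))
    (g : M → ℝ → ℝ≥0∞) (n : ℕ) (ω : Ω) : ℝ≥0∞ :=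
  ∏ s ∈ Finset.range n, ∏ i : M, if (i : Fin d) ∈ A s ω then g i (X s i ω) else 1

lemma ratio_eq_prod (X : ℕ → Fin d → Ω → ℝ) (A : ℕ → Ω → Finset (Fin d)) (M : Finset (Fin d))
    (g : M → ℝ → ℝ≥0∞) (n : ℕ) (ω : Ω) :
    ratio X A M g n ω =
      ∏ i : M, ∏ s ∈ (Finset.range n).filter (fun s => (i : Fin d) ∈ A s ω), g i (X s i ω) := by
  unfold ratio
  rw [Finset.prod_comm]
  simp_rw [Finset.prod_filter]

variable [MeasurableSpace Ω] {P : Measure Ω}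

lemma past_le (hU : Measurable U) (hX : ∀ s i, Measurable (X s i)) (s : ℕ) :
    past U X s ≤ (inferInstance : MeasurableSpace Ω) :=
  sup_le hU.comap_le (iSup₂_le fun p _ => (hX p.1 p.2).comap_le)

lemma present_le (hX : ∀ s i, Measurable (X s i)) (s : ℕ) :
    present X s ≤ (inferInstance : MeasurableSpace Ω) :=
  iSup₂_le fun p _ => (hX p.1 p.2).comap_le

lemma indep_past_present [IsProbabilityMeasure P] {θ : Fin d → unitInterval}
    (hX : IsRewards P θ X) (hA : IsPolicy P ℳ X U A) (s : ℕ) :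
    Indep (past U X s) (present X s) P := by
  have hm : ∀ p : ℕ × Fin d, MeasurableSpace.comap (X p.1 p.2) inferInstance ≤
      (inferInstance : MeasurableSpace Ω) := fun p => (hX.measurable p.1 p.2).comap_le
  refine indep_sup_left_of_indep hA.measurable_seed.comap_le (iSup₂_le fun p _ => hm p)
    (present_le hX.measurable s) ?_ ?_
  · have h : Indep (MeasurableSpace.comap U inferInstance)
      (MeasurableSpace.comap (fun ω (p : ℕ × Fin d) => X p.1 p.2 ω) inferInstance) P := hA.indep
    refine indep_of_indep_of_le_right h ?_
    have h1 : ∀ p : ℕ × Fin d, MeasurableSpace.comap (X p.1 p.2) inferInstance ≤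
        MeasurableSpace.comap (fun ω (p : ℕ × Fin d) => X p.1 p.2 ω) inferInstance := by
      intro p
      rw [← measurable_iff_comap_le]
      have e : Measurable fun y : ℕ × Fin d → ℝ => y p := measurable_pi_apply p
      exact e.comp (comap_measurable _)
    exact sup_le (iSup₂_le fun p _ => h1 p) (iSup₂_le fun p _ => h1 p)
  · refine indep_iSup_of_disjoint
      (m := fun p : ℕ × Fin d => MeasurableSpace.comap (X p.1 p.2) inferInstance) hm
      (iIndepFun.iIndep (f := fun p : ℕ × Fin d => X p.1 p.2) hX.indep) ?_
    rw [Set.disjoint_left]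
    intro p hp hp'
    have h1 : p.1 < s := hp
    have h2 : p.1 = s := hp'
    omega

/-- By strong induction, the earlier arms, and therefore what they reveal, are functions of the seed
and of the full past rewards. -/
lemma measurableSet_arm_eq (hA : IsPolicy P ℳ X U A) (s : ℕ) (B : Finset (Fin d)) :
    MeasurableSet[past U X s] {ω | A s ω = B} := by
  induction s using Nat.strong_induction_on generalizing B with
  | _ s ih =>
    have hAr : ∀ r < s, Measurable[past U X s, ⊤] (A r) := by
      intro r hr
      refine @measurable_to_countable' _ _ ⊤ _ (past U X s) (A r) fun B => ?_
      exact past_mono hr.le _ (ih r hr B)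
    have hle : information U X A s ≤ past U X s := by
      refine sup_le le_sup_left (iSup₂_le fun r hr => sup_le ?_ ?_)
      · exact measurable_iff_comap_le.1 (hAr r hr)
      · rw [← measurable_iff_comap_le]
        refine @measurable_pi_lambda Ω (Fin d) (fun _ => ℝ) (past U X s) _ _ fun i => ?_
        refine Measurable.ite ?_ (measurable_past hr i) measurable_const
        exact hAr r hr (show MeasurableSet[⊤] {B : Finset (Fin d) | i ∈ B} from trivial)
    exact hle _ (hA.nonanticipating s B)

lemma measurableSet_mem_arm (hA : IsPolicy P ℳ X U A) (s : ℕ) (i : Fin d) :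
    MeasurableSet[past U X s] {ω | i ∈ A s ω} := by
  have : Measurable[past U X s, ⊤] (A s) :=
    @measurable_to_countable' _ _ ⊤ _ (past U X s) (A s) fun B => measurableSet_arm_eq hA s B
  exact this (show MeasurableSet[⊤] {B : Finset (Fin d) | i ∈ B} from trivial)

lemma measurable_ratio (hA : IsPolicy P ℳ X U A) (M : Finset (Fin d)) {g : M → ℝ → ℝ≥0∞}
    (hg : ∀ i, Measurable (g i)) (n : ℕ) : Measurable[past U X n] (ratio X A M g n) := by
  refine Finset.measurable_fun_prod _ fun s hs => Finset.measurable_fun_prod _ fun i _ => ?_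
  have hs := Finset.mem_range.1 hs
  refine Measurable.ite (past_mono hs.le _ (measurableSet_mem_arm hA s i)) ?_ measurable_const
  exact (hg i).comp (measurable_past (X := X) hs i)

lemma lintegral_prod_ite_le [IsProbabilityMeasure P] {θ : Fin d → unitInterval}
    (hX : IsRewards P θ X) (M : Finset (Fin d)) {g : M → ℝ → ℝ≥0∞}
    (hg : ∀ i, Measurable (g i))
    (hg1 : ∀ i : M, ∫⁻ x, g i x ∂(bernoulliMeasure (1 : ℝ) 0 (θ i)) ≤ 1)
    (s : ℕ) (B : Finset (Fin d)) :
    ∫⁻ ω, ∏ i : M, (if (i : Fin d) ∈ B then g i (X s i ω) else 1) ∂P ≤ 1 := by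
  have hinj : Function.Injective fun i : M => (s, (i : Fin d)) := fun i j h =>
    Subtype.ext (Prod.mk.inj h).2
  have hmeas : ∀ i : M, Measurable fun x : ℝ => if (i : Fin d) ∈ B then g i x else 1 := by
    intro i
    split_ifs
    · exact hg i
    · exact measurable_const
  have hind := (hX.indep.precomp hinj).comp
    (fun (i : M) (x : ℝ) => if (i : Fin d) ∈ B then g i x else (1 : ℝ≥0∞)) hmeas
  have := lintegral_prod_eq_prod_lintegral_of_indepFun Finset.univ _ hind
    (fun i => (hmeas i).comp (hX.measurable s i))
  refine (le_of_eq this).trans (Finset.prod_le_one' fun i _ => ?_)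
  by_cases hi : (i : Fin d) ∈ B
  · simp only [Function.comp, hi, if_true]
    rw [← lintegral_map (hg i) (hX.measurable s i), hX.law s i]
    exact hg1 i
  · simp [Function.comp, hi]

/-- Supermartingale property: given the past, the new round multiplies the ratio by a factor of mean
at most 1. -/
lemma lintegral_ratio_le_one [IsProbabilityMeasure P] {θ : Fin d → unitInterval}
    (hX : IsRewards P θ X) (hA : IsPolicy P ℳ X U A) (M : Finset (Fin d)) {g : M → ℝ → ℝ≥0∞}
    (hg : ∀ i, Measurable (g i))
    (hg1 : ∀ i : M, ∫⁻ x, g i x ∂(bernoulliMeasure (1 : ℝ) 0 (θ i)) ≤ 1) (n : ℕ) :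
    ∫⁻ ω, ratio X A M g n ω ∂P ≤ 1 := by
  induction n with
  | zero => simp [ratio]
  | succ n ih =>
    have hpast := past_le hA.measurable_seed hX.measurable n
    have hZ := measurable_ratio hA M hg n
    have hf : ∀ B, Measurable[past U X n]
        fun ω => {ω | A n ω = B}.indicator (ratio X A M g n) ω :=
      fun B => hZ.indicator (measurableSet_arm_eq hA n B)
    have hY : ∀ B : Finset (Fin d), Measurable[present X n]
        fun ω => ∏ i : M, (if (i : Fin d) ∈ B then g i (X n i ω) else 1) := by
      intro B
      refine Finset.measurable_fun_prod _ fun i _ => ?_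
      split_ifs
      · exact (hg i).comp (measurable_present (X := X) n i)
      · exact measurable_const
    -- Splitting by the selected arm separates a past-measurable factor from a present-measurable
    -- one in each summand.
    have hdec : ∀ ω, ratio X A M g (n + 1) ω = ∑ B : Finset (Fin d),
        {ω | A n ω = B}.indicator (ratio X A M g n) ω *
          ∏ i : M, (if (i : Fin d) ∈ B then g i (X n i ω) else 1) := by
      intro ω
      rw [Finset.sum_eq_single (A n ω)]
      · rw [Set.indicator_of_mem (by simp)]
        exact Finset.prod_range_succ _ n
      · intro B _ hB
        rw [Set.indicator_of_notMem (by simpa using hB.symm), zero_mul]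
      · simp
    have hsplit : ∀ ω, ∑ B : Finset (Fin d), {ω | A n ω = B}.indicator (ratio X A M g n) ω
        = ratio X A M g n ω := by
      intro ω
      rw [Finset.sum_eq_single (A n ω)]
      · rw [Set.indicator_of_mem (by simp)]
      · intro B _ hB
        rw [Set.indicator_of_notMem (by simpa using hB.symm)]
      · simp
    simp_rw [hdec]
    rw [lintegral_finsetSum _ fun B _ => ((hf B).mono hpast le_rfl).fun_mul
      ((hY B).mono (present_le hX.measurable n) le_rfl)]
    calc ∑ B : Finset (Fin d), ∫⁻ ω, {ω | A n ω = B}.indicator (ratio X A M g n) ω *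
          ∏ i : M, (if (i : Fin d) ∈ B then g i (X n i ω) else 1) ∂P
        ≤ ∑ B : Finset (Fin d), ∫⁻ ω, {ω | A n ω = B}.indicator (ratio X A M g n) ω ∂P := by
          refine Finset.sum_le_sum fun B _ => ?_
          rw [lintegral_mul_eq_lintegral_mul_lintegral_of_independent_measurableSpace hpast
            (present_le hX.measurable n) (indep_past_present hX hA n) (hf B) (hY B)]
          exact mul_le_of_le_one_right' (lintegral_prod_ite_le hX M hg hg1 n B)
      _ = ∫⁻ ω, ratio X A M g n ω ∂P := by
          rw [← lintegral_finsetSum _ fun B _ => (hf B).mono hpast le_rfl]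
          simp_rw [hsplit]
      _ ≤ 1 := ih

end

/-! ### Summation over the rounds -/

lemma summable_inv_mul_log_sq :
    Summable fun k : ℕ => (((k + 2 : ℕ) : ℝ))⁻¹ * ((Real.log (k + 2 : ℕ)) ^ 2)⁻¹ := by
  -- The shift inside the logarithm avoids `log 1 = 0`, whose inverse 0 would break monotonicity in
  -- Cauchy condensation.
  let h : ℕ → ℝ := fun k => (k : ℝ)⁻¹ * ((Real.log (k + 1)) ^ 2)⁻¹
  have hpos : ∀ k : ℕ, 0 < k → 0 < Real.log ((k : ℝ) + 1) := fun k hk =>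
    Real.log_pos (by have : (0 : ℝ) < k := by exact_mod_cast hk
                     linarith)
  have hsum : Summable h := by
    rw [← summable_condensed_iff_of_nonneg (fun k => by positivity)]
    · have hs : Summable fun k : ℕ => ((Real.log 2) ^ 2)⁻¹ * (1 / (k : ℝ) ^ 2) :=
        (Real.summable_one_div_nat_pow.2 (by norm_num)).mul_left _
      -- The term `k = 0` is dropped, since there `1 / k ^ 2` reads as 0 and dominates nothing.
      refine (summable_nat_add_iff 1).1 (Summable.of_nonneg_of_le (fun k => by positivity) (fun k => ?_)
        ((summable_nat_add_iff 1).2 hs))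
      have h2 : (0 : ℝ) < 2 ^ (k + 1) := by positivity
      have hl2 : 0 < Real.log 2 := Real.log_pos (by norm_num)
      have hl : ((k + 1 : ℕ) : ℝ) * Real.log 2 ≤ Real.log (2 ^ (k + 1) + 1) := by
        rw [← Real.log_pow]
        exact Real.log_le_log h2 (by linarith)
      simp only [h, Nat.cast_pow, Nat.cast_ofNat]
      rw [mul_inv_cancel_left₀ h2.ne', one_div, ← mul_inv, ← mul_pow, mul_comm (Real.log 2)]
      gcongr
    · intro a b ha hab
      have h1 := hpos a ha
      have h0 : (0 : ℝ) < a := by exact_mod_cast ha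
      have hab' : (a : ℝ) ≤ b := by exact_mod_cast hab
      simp only [h]
      gcongr
  refine Summable.of_nonneg_of_le (fun k => by positivity) (fun k => ?_)
    ((summable_nat_add_iff 1).2 hsum)
  have h1 := hpos (k + 1) (by omega)
  simp only [h]
  push_cast at *
  have e : (k : ℝ) + 2 = k + 1 + 1 := by ring
  rw [e]
  gcongr
  linarith

lemma totalBound_lt_top {C : ℝ} (hC : 0 < C) : totalBound C < ⊤ := by
  unfold totalBound
  refine ENNReal.add_lt_top.2 ⟨by simp, ?_⟩
  have h := summable_inv_mul_log_sq.mul_left C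
  have : ∀ k : ℕ, rate C (k + 2)
      = ENNReal.ofReal (C * ((((k + 2 : ℕ) : ℝ))⁻¹ * ((Real.log (k + 2 : ℕ)) ^ 2)⁻¹)) := by
    intro k; unfold rate; rw [mul_assoc]
  simp_rw [this]
  rw [← ENNReal.ofReal_tsum_of_nonneg (fun k => by positivity) h]
  exact ENNReal.ofReal_lt_top

section

variable {Ω : Type*} [MeasurableSpace Ω] {P : Measure Ω}

lemma expectedRounds_le_tsum (P : Measure Ω) (E : ℕ → Set Ω) :
    expectedRounds P E ≤ ∑' k : ℕ, P (E (k + 1)) := by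
  -- Measurable hulls allow sum and integral to be exchanged without measurability of the events,
  -- and keep their measures.
  have hpt : ∀ ω, ((Set.encard {n : ℕ | 1 ≤ n ∧ ω ∈ E n} : ℕ∞) : ℝ≥0∞)
      ≤ ∑' k : ℕ, (toMeasurable P (E (k + 1))).indicator 1 ω := by
    intro ω
    have e : {n : ℕ | 1 ≤ n ∧ ω ∈ E n} = Nat.succ '' {k | ω ∈ E (k + 1)} := by
      ext n
      constructor
      · rintro ⟨h1, h2⟩
        obtain ⟨k, rfl⟩ := Nat.exists_eq_add_of_le' h1
        exact ⟨k, h2, rfl⟩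
      · rintro ⟨k, h, rfl⟩
        exact ⟨by omega, h⟩
    rw [e, Nat.succ_injective.encard_image, ← ENNReal.tsum_set_one,
      tsum_subtype {k | ω ∈ E (k + 1)} fun _ => (1 : ℝ≥0∞)]
    refine ENNReal.tsum_le_tsum fun k => ?_
    by_cases h : ω ∈ E (k + 1)
    · rw [Set.indicator_of_mem (show k ∈ {k | ω ∈ E (k + 1)} from h),
        Set.indicator_of_mem (subset_toMeasurable P _ h)]
      simp
    · rw [Set.indicator_of_notMem (show k ∉ {k | ω ∈ E (k + 1)} from h)]
      simp
  unfold expectedRounds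
  refine (lintegral_mono hpt).trans ?_
  rw [lintegral_tsum fun k =>
    (measurable_one.indicator (measurableSet_toMeasurable P (E (k + 1)))).aemeasurable]
  refine ENNReal.tsum_le_tsum fun k => ?_
  rw [lintegral_indicator_one (measurableSet_toMeasurable _ _), measure_toMeasurable]

lemma roundsBoundedBy_totalBound [IsProbabilityMeasure P] {E : ℕ → Set Ω} {C : ℝ}
    (h : ∀ n, 2 ≤ n → P (E n) ≤ rate C n) : RoundsBoundedBy P E (totalBound C) := by
  have hsum : ∑' k : ℕ, P (E (k + 1)) ≤ totalBound C := by
    -- The round `n = 1` is bounded trivially and accounts for the summand 1.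
    rw [tsum_eq_zero_add' ENNReal.summable]
    exact add_le_add prob_le_one (ENNReal.tsum_le_tsum fun k => h (k + 2) (by omega))
  exact ⟨hsum, (expectedRounds_le_tsum P E).trans hsum⟩

end

/-! ### The probability of a large deviation -/

lemma empMean_eq {d : ℕ} {Ω : Type*} (X : ℕ → Fin d → Ω → ℝ) (A : ℕ → Ω → Finset (Fin d)) (n : ℕ) (ω : Ω) (i : Fin d) :
    empMean X A n ω i = (∑ s ∈ (Finset.range n).filter (fun s => i ∈ A s ω), X s i ω) /
      (((Finset.range n).filter fun s => i ∈ A s ω).card : ℝ) := by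
  unfold empMean
  split_ifs with h
  · unfold count at h
    rw [h]; simp
  · rfl

section

variable {d : ℕ} {Ω S : Type*} [MeasurableSpace Ω] [MeasurableSpace S] {P : Measure Ω}
  {θ : Fin d → unitInterval} {U : Ω → S} {X : ℕ → Fin d → Ω → ℝ}
  {A : ℕ → Ω → Finset (Fin d)} {ℳ : Finset (Finset (Fin d))}

lemma ae_rewards (hX : IsRewards P θ X) :
    ∀ᵐ ω ∂P, ∀ s i, X s i ω ∈ Set.Icc (0 : ℝ) 1 ∧ ((θ i : ℝ) = 1 → X s i ω = 1) := by
  refine ae_all_iff.2 fun s => ae_all_iff.2 fun i => ?_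
  have h1 : ∀ᵐ x ∂(P.map (X s i)), x ∈ Set.Icc (0 : ℝ) 1 := by
    rw [hX.law s i, ae_iff]
    exact bernoulliMeasure_apply_of_notMem_of_notMem _
      (measurableSet_Icc.compl : MeasurableSet (Set.Icc (0 : ℝ) 1)ᶜ) (by simp) (by simp)
  have h2 : ∀ᵐ x ∂(P.map (X s i)), (θ i : ℝ) = 1 → x = 1 := by
    rw [hX.law s i]
    by_cases h : (θ i : ℝ) = 1
    · rw [show θ i = 1 from Subtype.ext h, bernoulliMeasure_one, ae_dirac_eq]
      simp
    · exact Filter.Eventually.of_forall fun x hx => absurd hx h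
  filter_upwards [ae_of_ae_map (hX.measurable s i).aemeasurable h1,
    ae_of_ae_map (hX.measurable s i).aemeasurable h2] with ω a b using ⟨a, b⟩

end

lemma empMean_mem_Icc {d : ℕ} {Ω : Type*} {X : ℕ → Fin d → Ω → ℝ}
    {A : ℕ → Ω → Finset (Fin d)} {ω : Ω} (h : ∀ s i, X s i ω ∈ Set.Icc (0 : ℝ) 1) (n : ℕ) (i : Fin d) :
    empMean X A n ω i ∈ Set.Icc (0 : ℝ) 1 := by
  rw [empMean_eq]
  refine ⟨div_nonneg (Finset.sum_nonneg fun s _ => (h s i).1) (Nat.cast_nonneg _),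
    div_le_one_of_le₀ ?_ (Nat.cast_nonneg _)⟩
  refine (Finset.sum_le_sum fun s _ => (h s i).2).trans ?_
  simp

lemma empMean_eq_one {d : ℕ} {Ω : Type*} {X : ℕ → Fin d → Ω → ℝ}
    {A : ℕ → Ω → Finset (Fin d)} {ω : Ω} {i : Fin d} (h : ∀ s, X s i ω = 1) {n : ℕ}
    (hn : count A n ω i ≠ 0) : empMean X A n ω i = 1 := by
  unfold empMean
  rw [if_neg hn, Finset.sum_congr rfl fun s _ => h s]
  simp only [Finset.sum_const, nsmul_eq_mul, mul_one]
  exact div_self (by exact_mod_cast hn)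

section

variable {d : ℕ} {Ω S : Type*} [MeasurableSpace Ω] [MeasurableSpace S] {P : Measure Ω}
  {θ : Fin d → unitInterval} {U : Ω → S} {X : ℕ → Fin d → Ω → ℝ}
  {A : ℕ → Ω → Finset (Fin d)} {ℳ : Finset (Finset (Fin d))}

/-- Truncation at `δ` is harmless: either one term alone reaches `δ`, or no term is truncated. -/
lemma sub_card_le_sum_min {ι : Type*} [Fintype ι] {y : ι → ℝ} {δ : ℝ} (hy : ∀ i, 0 ≤ y i)
    (hδ : 0 ≤ δ) (h : δ ≤ ∑ i, y i) :
    δ - Fintype.card ι ≤ ∑ i, (min (y i) δ - 1) := by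
  rw [Finset.sum_sub_distrib]
  have : δ ≤ ∑ i, min (y i) δ := by
    by_cases hex : ∃ i, δ ≤ y i
    · obtain ⟨i, hi⟩ := hex
      calc δ = min (y i) δ := (min_eq_right hi).symm
        _ ≤ _ := Finset.single_le_sum (f := fun i => min (y i) δ)
          (fun j _ => le_min (hy j) hδ) (Finset.mem_univ i)
    · push Not at hex
      rwa [Finset.sum_congr rfl fun i _ => min_eq_left (hex i).le]
  simpa using this

/-- The total downward deviation of the empirical means of the actions in `M`. -/
def totalDev (θ : Fin d → unitInterval) (X : ℕ → Fin d → Ω → ℝ) (A : ℕ → Ω → Finset (Fin d))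
    (M : Finset (Fin d)) (n : ℕ) (ω : Ω) : ℝ :=
  ∑ i ∈ M, count A n ω i * dev (empMean X A n ω i) (θ i)

/-- A deviation inequality for sums of Kullback-Leibler divergences. -/
lemma measure_le_totalDev_le [IsProbabilityMeasure P] (hX : IsRewards P θ X)
    (hA : IsPolicy P ℳ X U A) (M : Finset (Fin d)) {n : ℕ} {δ : ℝ} (hn : 1 ≤ n) (hδ : 1 ≤ δ)
    (hnδ : Real.log n ≤ δ) :
    P {ω | δ ≤ totalDev θ X A M n ω}
      ≤ ENNReal.ofReal ((7 * δ ^ 2) ^ M.card * Real.exp (M.card - δ)) := by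
  obtain ⟨K, hK, htest⟩ := exists_tests hn hδ hnδ
  choose g hg1 hg2 hg3 using htest
  let G : (M → Option (Fin K)) → M → ℝ → ℝ≥0∞ := fun k i => g (θ i) (k i)
  have hMG : ∀ k, P {ω | ENNReal.ofReal (Real.exp (δ - M.card)) ≤ ratio X A M (G k) n ω}
      ≤ ENNReal.ofReal (Real.exp (M.card - δ)) := by
    intro k
    have hmeas : Measurable (ratio X A M (G k) n) :=
      (measurable_ratio hA M (fun i => hg1 (θ i) (k i)) n).mono
        (past_le hA.measurable_seed hX.measurable n) le_rfl
    refine (meas_ge_le_lintegral_div hmeas.aemeasurable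
      (by simpa using Real.exp_pos _) ENNReal.ofReal_ne_top).trans ?_
    refine (ENNReal.div_le_div_right (lintegral_ratio_le_one hX hA M
      (fun i => hg1 (θ i) (k i)) (fun i => hg2 (θ i) (k i)) n) _).trans ?_
    rw [one_div, ← ENNReal.ofReal_inv_of_pos (Real.exp_pos _), ← Real.exp_neg, neg_sub]
  have hsub : ∀ᵐ ω ∂P, ω ∈ {ω | δ ≤ totalDev θ X A M n ω} →
      ω ∈ ⋃ k, {ω | ENNReal.ofReal (Real.exp (δ - M.card)) ≤ ratio X A M (G k) n ω} := by
    filter_upwards [ae_rewards hX] with ω hω hdev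
    have hIcc : ∀ s i, X s i ω ∈ Set.Icc (0 : ℝ) 1 := fun s i => (hω s i).1
    -- The successful tests depend on `ω`, whence the union over all choices `k`.
    choose k hk using fun i : M => hg3 (θ i)
      ((Finset.range n).filter fun s => (i : Fin d) ∈ A s ω) (fun s => X s i ω)
      ((Finset.card_filter_le _ _).trans (by simp)) (fun s _ => hIcc s i)
    refine Set.mem_iUnion.2 ⟨k, ?_⟩
    rw [Set.mem_ofPred_eq, ratio_eq_prod]
    refine le_trans ?_ (Finset.prod_le_prod' fun i _ => hk i)
    rw [← ENNReal.ofReal_prod_of_nonneg (fun s _ => (Real.exp_pos _).le), ← Real.exp_sum]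
    refine ENNReal.ofReal_le_ofReal (Real.exp_le_exp.2 ?_)
    simp_rw [← empMean_eq]
    have := sub_card_le_sum_min (ι := M)
      (y := fun i => count A n ω i * dev (empMean X A n ω i) (θ i)) (δ := δ)
      (fun i => mul_nonneg (Nat.cast_nonneg _) (dev_nonneg (empMean_mem_Icc hIcc n i).1))
      (by linarith) (by
        rw [Finset.sum_coe_sort M fun i => count A n ω i * dev (empMean X A n ω i) (θ i)]
        exact hdev)
    rwa [Fintype.card_coe] at this
  calc P {ω | δ ≤ totalDev θ X A M n ω}
      ≤ P (⋃ k, {ω | ENNReal.ofReal (Real.exp (δ - M.card)) ≤ ratio X A M (G k) n ω}) :=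
        measure_mono_ae hsub
    _ ≤ ∑ k, P {ω | ENNReal.ofReal (Real.exp (δ - M.card)) ≤ ratio X A M (G k) n ω} :=
        measure_iUnion_fintype_le P _
    _ ≤ ∑ _k : M → Option (Fin K), ENNReal.ofReal (Real.exp (M.card - δ)) :=
        Finset.sum_le_sum fun k _ => hMG k
    _ = ENNReal.ofReal ((K + 1 : ℝ) ^ M.card * Real.exp (M.card - δ)) := by
        rw [Finset.sum_const, nsmul_eq_mul, ENNReal.ofReal_mul (by positivity)]
        congr 1
        rw [ENNReal.ofReal_pow (by positivity)]
        simp [ENNReal.ofReal_add, Finset.card_univ]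
    _ ≤ _ := by
        refine ENNReal.ofReal_le_ofReal ?_
        gcongr

end

/-! ### The constant and the probability bounds for both indexes -/

/-- The constant `C_m`. -/
def rateConst (m : ℕ) : ℝ := (7 * (1 + 4 * m) ^ 2 * Real.exp 1) ^ m + 2

lemma rateConst_pos (m : ℕ) : 0 < rateConst m := by unfold rateConst; positivity

lemma deviation_bound_le {m n : ℕ} (hm : 1 ≤ m) (hn : 3 ≤ n) :
    (7 * fR m n ^ 2) ^ m * Real.exp (m - fR m n)
      ≤ rateConst m * (n : ℝ)⁻¹ * ((Real.log n) ^ 2)⁻¹ := by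
  have hL := one_le_log hn
  have hn0 : (0 : ℝ) < n := by positivity
  have hf0 : 0 ≤ fR m n := by linarith [log_le_fR m hn]
  set L := Real.log n with hLdef
  have hL0 : 0 < L := by linarith
  have hf : fR m n ≤ (1 + 4 * m) * L := by
    unfold fR
    have := Real.log_le_sub_one_of_pos hL0
    have : 4 * (m : ℝ) * Real.log L ≤ 4 * m * L := by gcongr; linarith
    rw [← hLdef]
    linarith
  have hexp : Real.exp (m - fR m n) = Real.exp 1 ^ m * (n : ℝ)⁻¹ * (L ^ (4 * m))⁻¹ := by
    have : (m : ℝ) - fR m n = m * 1 - L - ((4 * m : ℕ) : ℝ) * Real.log L := by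
      unfold fR; rw [← hLdef]; push_cast; ring
    rw [this, Real.exp_sub, Real.exp_sub, Real.exp_nat_mul, Real.exp_nat_mul, Real.exp_log hL0,
      hLdef, Real.exp_log hn0]
    field_simp
  rw [hexp]
  calc (7 * fR m n ^ 2) ^ m * (Real.exp 1 ^ m * (n : ℝ)⁻¹ * (L ^ (4 * m))⁻¹)
      ≤ (7 * ((1 + 4 * m) * L) ^ 2) ^ m * (Real.exp 1 ^ m * (n : ℝ)⁻¹ * (L ^ (4 * m))⁻¹) := by
        gcongr
    -- Half of the power `4 * m` of `L` cancels the growth of `(f ^ 2) ^ m`.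
    _ = (7 * (1 + 4 * m) ^ 2 * Real.exp 1) ^ m * (n : ℝ)⁻¹ * (L ^ (2 * m))⁻¹ := by
        have e : L ^ (4 * m) = L ^ (2 * m) * L ^ (2 * m) := by rw [← pow_add]; congr 1; ring
        rw [e]
        simp only [mul_pow, ← pow_mul]
        field_simp
    _ ≤ rateConst m * (n : ℝ)⁻¹ * (L ^ 2)⁻¹ := by
        have h1 : (7 * (1 + 4 * (m : ℝ)) ^ 2 * Real.exp 1) ^ m ≤ rateConst m := by
          unfold rateConst; linarith
        have h2 : L ^ 2 ≤ L ^ (2 * m) := pow_le_pow_right₀ hL (by omega)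
        have h3 := rateConst_pos m
        gcongr

/-- At `n = 2` with `m ≥ 1`, `f` is negative and the index is `-∞`, so the bound must be trivial
there; the summand 2 in `rateConst` ensures this. -/
lemma one_le_rate_two (m : ℕ) : 1 ≤ rate (rateConst m) 2 := by
  unfold rate
  rw [ENNReal.one_le_ofReal]
  have h1 := Real.log_two_lt_d9
  have h0 : 0 < Real.log 2 := Real.log_pos (by norm_num)
  have h2 : 2 ≤ rateConst m := by
    unfold rateConst
    linarith [show 0 ≤ (7 * (1 + 4 * (m : ℝ)) ^ 2 * Real.exp 1) ^ m by positivity]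
  have h3 : (Real.log 2) ^ 2 ≤ 1 := by nlinarith
  have h4 : 1 ≤ ((Real.log 2) ^ 2)⁻¹ := (one_le_inv₀ (by positivity)).2 h3
  push_cast
  nlinarith

section

variable {d : ℕ} {Ω S : Type*} [MeasurableSpace Ω] [MeasurableSpace S] {P : Measure Ω}
  {θ : Fin d → unitInterval} {U : Ω → S} {X : ℕ → Fin d → Ω → ℝ}
  {A : ℕ → Ω → Finset (Fin d)} {ℳ : Finset (Finset (Fin d))}

lemma measure_fR_le_totalDev_le [IsProbabilityMeasure P] (hX : IsRewards P θ X)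
    (hA : IsPolicy P ℳ X U A) {m n : ℕ} {M : Finset (Fin d)} (hM : M.card = m) (hn : 2 ≤ n) :
    P {ω | fR m n ≤ totalDev θ X A M n ω} ≤ rate (rateConst m) n := by
  -- For `m = 0` the sum is empty and `f(n) = log n > 0`, so the event is empty;
  -- `deviation_bound_le` needs `m ≥ 1`.
  rcases Nat.eq_zero_or_pos m with h0 | hm
  · have hM0 : M = ∅ := Finset.card_eq_zero.1 (hM.trans h0)
    have : {ω | fR m n ≤ totalDev θ X A M n ω} = ∅ := by
      ext ω
      have : 0 < Real.log n := Real.log_pos (by exact_mod_cast hn)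
      simpa [totalDev, hM0, fR, h0] using this
    rw [this]
    simp
  rcases hn.eq_or_lt with h | h
  · rw [← h]
    exact prob_le_one.trans (one_le_rate_two m)
  · have h1 := one_le_log h
    have h2 := log_le_fR m h
    refine (measure_le_totalDev_le hX hA M (by omega) (h1.trans h2) h2).trans ?_
    rw [hM]
    exact ENNReal.ofReal_le_ofReal (deviation_bound_le hm h)

lemma ae_meanReward_le_bHat (hX : IsRewards P θ X) (A : ℕ → Ω → Finset (Fin d)) (m : ℕ) {n : ℕ}
    (M : Finset (Fin d)) (hn : 2 ≤ n) :
    ∀ᵐ ω ∂P, totalDev θ X A M n ω < fR m n →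
      meanReward θ M ≤ bHat m X A M n ω ∧
        ((∃ i ∈ M, θ i ≠ 1) → meanReward θ M < bHat m X A M n ω) := by
  filter_upwards [ae_rewards hX] with ω hω hdev
  have hτ := empMean_mem_Icc (A := A) (fun s i => (hω s i).1) n
  have h1 : ∀ i, count A n ω i ≠ 0 → (θ i : ℝ) = 1 → empMean X A n ω i = 1 :=
    fun i hi hθ => empMean_eq_one (fun s => (hω s i).2 hθ) hi
  exact ⟨meanReward_le_b hn hτ h1 hdev, fun hθ => meanReward_lt_b hn hτ h1 hθ hdev⟩

lemma ae_bHat_le_cHat (hX : IsRewards P θ X) (A : ℕ → Ω → Finset (Fin d)) {m n : ℕ}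
    {M : Finset (Fin d)} (hM : M.card = m) (hn : 1 ≤ n) :
    ∀ᵐ ω ∂P, bHat m X A M n ω ≤ cHat m X A M n ω := by
  filter_upwards [ae_rewards hX] with ω hω
  exact b_le_c hM hn _ (empMean_mem_Icc (fun s i => (hω s i).1) n)

lemma measure_bHat_lt_le [IsProbabilityMeasure P] (hX : IsRewards P θ X)
    (hA : IsPolicy P ℳ X U A) {m n : ℕ} {M : Finset (Fin d)} (hM : M.card = m) (hn : 2 ≤ n) :
    P {ω | bHat m X A M n ω < meanReward θ M} ≤ rate (rateConst m) n := by
  refine le_trans (measure_mono_ae ?_) (measure_fR_le_totalDev_le hX hA hM hn)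
  filter_upwards [ae_meanReward_le_bHat hX A m M hn] with ω hω hlt
  by_contra! h
  exact (hω (not_le.1 h)).1.not_gt hlt

lemma measure_bHat_le_le [IsProbabilityMeasure P] (hX : IsRewards P θ X)
    (hA : IsPolicy P ℳ X U A) {m n : ℕ} {M : Finset (Fin d)} (hM : M.card = m) (hn : 2 ≤ n)
    (hθ : ∃ i ∈ M, θ i ≠ 1) :
    P {ω | bHat m X A M n ω ≤ meanReward θ M} ≤ rate (rateConst m) n := by
  refine le_trans (measure_mono_ae ?_) (measure_fR_le_totalDev_le hX hA hM hn)
  filter_upwards [ae_meanReward_le_bHat hX A m M hn] with ω hω hle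
  by_contra! h
  exact ((hω (not_le.1 h)).2 hθ).not_ge hle

lemma measure_cHat_lt_le [IsProbabilityMeasure P] (hX : IsRewards P θ X)
    (hA : IsPolicy P ℳ X U A) {m n : ℕ} {M : Finset (Fin d)} (hM : M.card = m) (hn : 2 ≤ n) :
    P {ω | cHat m X A M n ω < meanReward θ M} ≤ rate (rateConst m) n := by
  refine le_trans (measure_mono_ae ?_) (measure_bHat_lt_le hX hA hM hn)
  filter_upwards [ae_bHat_le_cHat hX A hM (by omega : 1 ≤ n)] with ω hω hlt
  exact lt_of_le_of_lt hω hlt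

lemma measure_cHat_le_le [IsProbabilityMeasure P] (hX : IsRewards P θ X)
    (hA : IsPolicy P ℳ X U A) {m n : ℕ} {M : Finset (Fin d)} (hM : M.card = m) (hn : 2 ≤ n)
    (hθ : ∃ i ∈ M, θ i ≠ 1) :
    P {ω | cHat m X A M n ω ≤ meanReward θ M} ≤ rate (rateConst m) n := by
  refine le_trans (measure_mono_ae ?_) (measure_bHat_le_le hX hA hM hn hθ)
  filter_upwards [ae_bHat_le_cHat hX A hM (by omega : 1 ≤ n)] with ω hω hle
  exact hω.trans hle

end

end CombBandit

end

theorem theorem3 (m : ℕ) :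
    (∀ (d : ℕ) (ℳ : Finset (Finset (Fin d))), (∀ M ∈ ℳ, M.card = m) →
      ∀ (n : ℕ), 1 ≤ n → ∀ M ∈ ℳ, ∀ (t : Fin d → ℕ) (τ : Fin d → ℝ),
        (∀ i, τ i ∈ Set.Icc (0 : ℝ) 1) → CombBandit.b m n t τ M ≤ CombBandit.c m n t τ M) ∧
    ∃ C : ℝ, 0 < C ∧ CombBandit.totalBound C < ⊤ ∧
      ∀ (d : ℕ) (ℳ : Finset (Finset (Fin d))), (∀ M ∈ ℳ, M.card = m) →
      ∀ (θ : Fin d → unitInterval)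
        (Ω : Type*) [MeasurableSpace Ω] (P : Measure Ω) [IsProbabilityMeasure P]
        (S : Type*) [MeasurableSpace S] (U : Ω → S)
        (X : ℕ → Fin d → Ω → ℝ) (A : ℕ → Ω → Finset (Fin d)),
        CombBandit.IsRewards P θ X → CombBandit.IsPolicy P ℳ X U A →
        (∀ M ∈ ℳ, ∀ n : ℕ, 2 ≤ n →
          P {ω | CombBandit.bHat m X A M n ω < CombBandit.meanReward θ M} ≤ CombBandit.rate C n ∧
          ((∃ i ∈ M, θ i ≠ 1) → P {ω | CombBandit.bHat m X A M n ω ≤ CombBandit.meanReward θ M} ≤ CombBandit.rate C n)) ∧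
        (∀ M ∈ ℳ, (∀ M' ∈ ℳ, CombBandit.meanReward θ M' ≤ CombBandit.meanReward θ M) →
          CombBandit.RoundsBoundedBy P
            (fun n : ℕ => {ω | CombBandit.bHat m X A M n ω < CombBandit.meanReward θ M}) (CombBandit.totalBound C) ∧
          CombBandit.RoundsBoundedBy P
            (fun n : ℕ => {ω | CombBandit.cHat m X A M n ω < CombBandit.meanReward θ M}) (CombBandit.totalBound C) ∧
          ((∃ i ∈ M, θ i ≠ 1) →
            CombBandit.RoundsBoundedBy P
            (fun n : ℕ => {ω | CombBandit.bHat m X A M n ω ≤ CombBandit.meanReward θ M})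
              (CombBandit.totalBound C) ∧
            CombBandit.RoundsBoundedBy P
            (fun n : ℕ => {ω | CombBandit.cHat m X A M n ω ≤ CombBandit.meanReward θ M})
              (CombBandit.totalBound C))) := by
  refine ⟨fun d ℳ hℳ n hn M hM t τ hτ => CombBandit.b_le_c (hℳ M hM) hn t hτ,
    CombBandit.rateConst m, CombBandit.rateConst_pos m,
    CombBandit.totalBound_lt_top (CombBandit.rateConst_pos m), ?_⟩
  intro d ℳ hℳ θ Ω _ P _ S _ U X A hX hA
  refine ⟨fun M hM n hn => ⟨CombBandit.measure_bHat_lt_le hX hA (hℳ M hM) hn,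
    CombBandit.measure_bHat_le_le hX hA (hℳ M hM) hn⟩, fun M hM _ => ⟨?_, ?_, fun hθ => ⟨?_, ?_⟩⟩⟩
  · exact CombBandit.roundsBoundedBy_totalBound fun n hn =>
      CombBandit.measure_bHat_lt_le hX hA (hℳ M hM) hn
  · exact CombBandit.roundsBoundedBy_totalBound fun n hn =>
      CombBandit.measure_cHat_lt_le hX hA (hℳ M hM) hn
  · exact CombBandit.roundsBoundedBy_totalBound fun n hn =>
      CombBandit.measure_bHat_le_le hX hA (hℳ M hM) hn hθ
  · exact CombBandit.roundsBoundedBy_totalBound fun n hn =>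
      CombBandit.measure_cHat_le_le hX hA (hℳ M hM) hn hθ
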